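/- Let $q\ge 2$ be an integer and $\epsilon_1,\epsilon_2\in[0,(q-1)/q]$. Consider the memoryless two-way channel over $\mathbb Z/q\mathbb Z$ given by $Y_{1n}=X_{1n}+X_{2n}+Z_{1n}$ and $Y_{2n}=X_{1n}+X_{2n}+Z_{2n}$ (modulo $q$), where the noise processes $\{Z_{1n}\}$ and $\{Z_{2n}\}$ are memoryless, independent of each other and of the sources, with $\Pr(Z_{in}=0)=1-\epsilon_i$ and $\Pr(Z_{in}=j)=\epsilon_i/(q-1)$ for $j\ne 0$. The memoryless sources $\{U_{1m}\}$ and $\{U_{2m}\}$ are independent of each other and uniformly distributed on $\mathbb Z/q\mathbb Z$; for $q=2$ this includes the uniform binary source pair in which $U_{2}$ is the output of a binary symmetric channel with input $U_{1}$ and crossover probability $\delta$, when its correlation coefficient $\rho=1-2\delta$ is $0$. A code with $K$ source symbols per terminal and $N$ channel uses consists of encoders $X_{in}=f_{in}(U_i^K,Y_i^{n-1})$, $n=1,\dots,N$, which may adapt to the symbols already received, and decoders $\hat U_j^K=g_i(U_i^K,Y_i^N)$, for $i\ne j$ in $\{1,2\}$. Its distortions are $\mathbb E[d(U_i^K,\hat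 U_i^K)]=K^{-1}\sum_{m=1}^K\Pr(U_{im}\neq\hat U_{im})$, $i=1,2$ (Hamming distortion). A pair $(D_1,D_2)$ is achievable at rate $1$ if there are codes, one for each $K$, with $K/N_K\to 1$ and $\limsup_{K\to\infty}\mathbb E[d(U_i^K,\hat U_i^K)]\le D_i$ for $i=1,2$. Then: 1. Every pair $(D_1,D_2)$ that is achievable at rate $1$ satisfies $D_1\ge\epsilon_2$ and $D_2\ge\epsilon_1$. 2. For every $N\ge1$, every code with $K=N$ has distortions at least $\epsilon_2$ (for $U_1^N$) and at least $\epsilon_1$ (for $U_2^N$). 3. For every $N\ge1$, uncoded transmission $X_{in}=U_{in}$ with the symbol-by-symbol decoders $\hat U_{1n}=Y_{2n}-U_{2n}$ and $\hat U_{2n}=Y_{1n}-U_{1n}$ (modulo $q$) has distortions exactly $\epsilon_2$ (for $U_1^N$) and $\epsilon_1$ (for $U_2^N$); by part 2 no other decoder does better. 4. In particular $(\epsilon_2,\epsilon_1)$ is achievable at rate $1$, so it is the smallest achievable pair in both coordinates and scalar coding is optimal. -/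

import Mathlib

open Filter Topology

/-- A two-way joint source-channel code with `K` source symbols per terminal and `N` channel uses.
Terminal `i` computes its `n`-th channel input from its own source block and its own
previously received symbols (adaptive encoding); after `N` uses it estimates the source block of
the other terminal from its own source block and its whole received block. -/
structure TWCode (U₁ U₂ X₁ X₂ Y₁ Y₂ : Type*) (K N : ℕ) where
  f₁ : (n : Fin N) → (Fin K → U₁) → (Fin n → Y₁) → X₁
  f₂ : (n : Fin N) → (Fin K → U₂) → (Fin n → Y₂) → X₂
  g₁ : (Fin K → U₁) → (Fin N → Y₁) → (Fin K → U₂)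
  g₂ : (Fin K → U₂) → (Fin N → Y₂) → (Fin K → U₁)

/-- The symbols of `y` strictly before time `n`. -/
def past {Y : Type*} {N : ℕ} (y : Fin N → Y) (n : Fin N) : Fin n → Y :=
  fun i => y ⟨i, i.isLt.trans n.isLt⟩

/-- The average of the single-letter distortion `d` over a block of length `K`. -/
noncomputable def blockDistortion {U : Type*} {K : ℕ} (d : U → U → ℝ) (u v : Fin K → U) : ℝ :=
  (K : ℝ)⁻¹ * ∑ m, d (u m) (v m)

section System

variable {U₁ U₂ X₁ X₂ Y₁ Y₂ : Type*}

/-- Joint probability of the source blocks and the received blocks when the code `c` is used over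
the memoryless two-way channel `W x₁ x₂ y₁ y₂ = p(y₁, y₂ | x₁, x₂)` with the memoryless joint
source `pS u₁ u₂`. -/
noncomputable def jointProb (pS : U₁ → U₂ → ℝ) (W : X₁ → X₂ → Y₁ → Y₂ → ℝ) {K N : ℕ}
    (c : TWCode U₁ U₂ X₁ X₂ Y₁ Y₂ K N)
    (u₁ : Fin K → U₁) (u₂ : Fin K → U₂) (y₁ : Fin N → Y₁) (y₂ : Fin N → Y₂) : ℝ :=
  (∏ m, pS (u₁ m) (u₂ m)) *
    ∏ n, W (c.f₁ n u₁ (past y₁ n)) (c.f₂ n u₂ (past y₂ n)) (y₁ n) (y₂ n)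

variable [Fintype U₁] [Fintype U₂] [Fintype Y₁] [Fintype Y₂]

/-- Expected distortion of the reconstruction, at terminal 2, of the source of terminal 1. -/
noncomputable def expDistortion₁ (pS : U₁ → U₂ → ℝ) (W : X₁ → X₂ → Y₁ → Y₂ → ℝ)
    (d : U₁ → U₁ → ℝ) {K N : ℕ} (c : TWCode U₁ U₂ X₁ X₂ Y₁ Y₂ K N) : ℝ :=
  ∑ u₁ : Fin K → U₁, ∑ u₂ : Fin K → U₂, ∑ y₁ : Fin N → Y₁, ∑ y₂ : Fin N → Y₂,
    jointProb pS W c u₁ u₂ y₁ y₂ * blockDistortion d u₁ (c.g₂ u₂ y₂)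

/-- Expected distortion of the reconstruction, at terminal 1, of the source of terminal 2. -/
noncomputable def expDistortion₂ (pS : U₁ → U₂ → ℝ) (W : X₁ → X₂ → Y₁ → Y₂ → ℝ)
    (d : U₂ → U₂ → ℝ) {K N : ℕ} (c : TWCode U₁ U₂ X₁ X₂ Y₁ Y₂ K N) : ℝ :=
  ∑ u₁ : Fin K → U₁, ∑ u₂ : Fin K → U₂, ∑ y₁ : Fin N → Y₁, ∑ y₂ : Fin N → Y₂,
    jointProb pS W c u₁ u₂ y₁ y₂ * blockDistortion d u₂ (c.g₁ u₁ y₁)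

/-- The pair `(D₁, D₂)` is achievable at rate `r` (source symbols per channel use): some sequence
of codes, one for each source blocklength `K`, with `K / N K → r`, has limiting expected
distortions at most `D₁` and `D₂`. -/
def Achievable (pS : U₁ → U₂ → ℝ) (W : X₁ → X₂ → Y₁ → Y₂ → ℝ)
    (d₁ : U₁ → U₁ → ℝ) (d₂ : U₂ → U₂ → ℝ) (r D₁ D₂ : ℝ) : Prop :=
  ∃ (N : ℕ → ℕ) (c : ∀ K : ℕ, TWCode U₁ U₂ X₁ X₂ Y₁ Y₂ K (N K)),
    (∀ K, 0 < K → 0 < N K) ∧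
    Tendsto (fun K : ℕ => (K : ℝ) / (N K : ℝ)) atTop (𝓝 r) ∧
    limsup (fun K : ℕ => expDistortion₁ pS W d₁ (c K)) atTop ≤ D₁ ∧
    limsup (fun K : ℕ => expDistortion₂ pS W d₂ (c K)) atTop ≤ D₂

end System

/-- Scalar coding: `N = K`, with symbol-by-symbol encoders `h₁, h₂` and symbol-by-symbol decoders
`g₁, g₂`. -/
def scalarCode {U₁ U₂ X₁ X₂ Y₁ Y₂ : Type*} (h₁ : U₁ → X₁) (h₂ : U₂ → X₂)
    (g₁ : U₁ → Y₁ → U₂) (g₂ : U₂ → Y₂ → U₁) (N : ℕ) : TWCode U₁ U₂ X₁ X₂ Y₁ Y₂ N N where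
  f₁ := fun n u _ => h₁ (u n)
  f₂ := fun n u _ => h₂ (u n)
  g₁ := fun u y n => g₁ (u n) (y n)
  g₂ := fun u y n => g₂ (u n) (y n)

/-- Hamming distortion. -/
def hamming {U : Type*} [DecidableEq U] (u v : U) : ℝ := if u = v then 0 else 1

/-- Law of the `q`-ary noise: `0` has probability `1 - ε` and each other symbol `ε / (q - 1)`. -/
noncomputable def noiseLaw (q : ℕ) (ε : ℝ) (z : ZMod q) : ℝ :=
  if z = 0 then 1 - ε else ε / ((q : ℝ) - 1)

/-- Transition probability of the two-way channel `Y₁ = X₁ + X₂ + Z₁`, `Y₂ = X₁ + X₂ + Z₂` over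
the integers mod `q`, with independent noises `Z₁`, `Z₂` of parameters `ε₁`, `ε₂`. -/
noncomputable def additiveTWC (q : ℕ) (ε₁ ε₂ : ℝ) (x₁ x₂ y₁ y₂ : ZMod q) : ℝ :=
  noiseLaw q ε₁ (y₁ - (x₁ + x₂)) * noiseLaw q ε₂ (y₂ - (x₁ + x₂))

/-- Uncoded transmission over the additive channel: each terminal sends its source symbols as they
are and subtracts its own symbol from what it receives. -/
def uncoded (q N : ℕ) : TWCode (ZMod q) (ZMod q) (ZMod q) (ZMod q) (ZMod q) (ZMod q) N N :=
  scalarCode id id (fun u y => y - u) (fun u y => y - u) N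

/-! Given both source blocks, the received words are determined by the noise words through a
bijection, whatever the feedback in the encoders. Hence replacing the law of `Z₂` by the uniform law
makes `Y₂` uniform and independent of the uniform block `U₁`, so that every reconstruction of `U₁`
is a pure guess, and its number of errors, increased by `N - K`, stochastically dominates the
Hamming weight of `Z₂`. The true law of `Z₂` has density `w (weight of Z₂)` for a nonincreasing
function `w ≥ 0`, and a concave function `F` with slope `w` satisfies
`F b - F a ≤ w a * (b - a)`. Taking `a` to be the noise weight and `b` the increased number of
errors, the stochastic domination makes the left side nonnegative on average under the uniform
law, while the right side averages to a difference of expectations under the true law: the expected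
number of errors is at least the expected noise weight minus `N - K`. Uncoded transmission errs
exactly where the noise is nonzero, which is equality for `N = K`. -/

section StochasticDominance

variable {R : Type*} [CommRing R] [LinearOrder R] [IsStrictOrderedRing R]

theorem sum_range_sub_sum_range_le_of_antitone {w : ℕ → R} (hw : Antitone w) (a b : ℕ) :
    ∑ j ∈ Finset.range b, w j - ∑ j ∈ Finset.range a, w j ≤ w a * ((b : R) - a) := by
  rcases le_total a b with hab | hba
  · have h := Finset.sum_le_card_nsmul (Finset.Ico a b) w (w a)
      fun j hj => hw (Finset.mem_Ico.1 hj).1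
    rw [Finset.sum_Ico_eq_sub _ hab, Nat.card_Ico, nsmul_eq_mul, Nat.cast_sub hab] at h
    linarith
  · have h := Finset.card_nsmul_le_sum (Finset.Ico b a) w (w a)
      fun j hj => hw (Finset.mem_Ico.1 hj).2.le
    rw [Finset.sum_Ico_eq_sub _ hba, Nat.card_Ico, nsmul_eq_mul, Nat.cast_sub hba] at h
    linarith

theorem sum_mul_antitone_mul_le_of_dominated {ι : Type*} {s : Finset ι} {P : ι → R} {a b : ι → ℕ}
    {w : ℕ → R} (hP : ∀ i ∈ s, 0 ≤ P i) (hw : Antitone w) (hw₀ : ∀ k, 0 ≤ w k)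
    (hab : ∀ F : ℕ → R, Monotone F → ∑ i ∈ s, P i * F (a i) ≤ ∑ i ∈ s, P i * F (b i)) :
    ∑ i ∈ s, P i * (w (a i) * a i) ≤ ∑ i ∈ s, P i * (w (a i) * b i) := by
  -- `F` is concave with slope `w`, so it lies below its tangent at `a i`.
  set F : ℕ → R := fun k => ∑ j ∈ Finset.range k, w j
  have hF : Monotone F := monotone_nat_of_le_succ fun k => by
    simpa only [F, Finset.sum_range_succ, le_add_iff_nonneg_right] using hw₀ k
  have tangent : ∑ i ∈ s, (P i * F (b i) - P i * F (a i)) ≤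
      ∑ i ∈ s, (P i * (w (a i) * b i) - P i * (w (a i) * a i)) := by
    refine Finset.sum_le_sum fun i hi => ?_
    rw [← mul_sub, ← mul_sub, ← mul_sub]
    exact mul_le_mul_of_nonneg_left
      (sum_range_sub_sum_range_le_of_antitone hw (a i) (b i)) (hP i hi)
  simp only [Finset.sum_sub_distrib] at tangent
  linarith [hab F hF]

end StochasticDominance

section HammingWeight

theorem hammingNorm_append {G : Type*} [DecidableEq G] [Zero G] {k m : ℕ} (u : Fin k → G)
    (v : Fin m → G) : hammingNorm (Fin.append u v) = hammingNorm u + hammingNorm v := by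
  simp only [hammingNorm, Finset.card_filter, Fin.sum_univ_add, Fin.append_left, Fin.append_right]

variable {G R : Type*} [Fintype G] [DecidableEq G] [CommRing R] [LinearOrder R]
  [IsStrictOrderedRing R]

theorem sum_hammingNorm_add [Zero G] {M : Type*} [AddCommMonoid M] (F : ℕ → M) (k m : ℕ) :
    ∑ z : Fin (k + m) → G, F (hammingNorm z) =
      ∑ u : Fin k → G, ∑ v : Fin m → G, F (hammingNorm u + hammingNorm v) := by
  rw [← (Fin.appendEquiv k m).sum_comp, Fintype.sum_prod_type]
  simp only [Fin.appendEquiv, Equiv.coe_fn_mk, hammingNorm_append]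

theorem card_pow_mul_sum_hammingNorm_le [Zero G] {F : ℕ → R} (hF : Monotone F) (k m : ℕ) :
    (Fintype.card G : R) ^ m * ∑ u : Fin k → G, F (hammingNorm u) ≤
      ∑ z : Fin (k + m) → G, F (hammingNorm z) := by
  rw [sum_hammingNorm_add, Finset.mul_sum]
  refine Finset.sum_le_sum fun u _ => ?_
  simpa using Finset.card_nsmul_le_sum (Finset.univ : Finset (Fin m → G))
    (fun v => F (hammingNorm u + hammingNorm v)) _ fun v _ => hF (Nat.le_add_right _ _)

theorem sum_hammingNorm_le_card_pow_mul [Zero G] {F : ℕ → R} (hF : Monotone F) (k m : ℕ) :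
    ∑ z : Fin (k + m) → G, F (hammingNorm z) ≤
      (Fintype.card G : R) ^ m * ∑ u : Fin k → G, F (hammingNorm u + m) := by
  rw [sum_hammingNorm_add, Finset.mul_sum]
  refine Finset.sum_le_sum fun u _ => ?_
  have hweight (v : Fin m → G) : hammingNorm v ≤ m := by
    simpa using hammingNorm_le_card_fintype (x := v)
  simpa using Finset.sum_le_card_nsmul (Finset.univ : Finset (Fin m → G))
    (fun v => F (hammingNorm u + hammingNorm v)) _
    fun v _ => hF (Nat.add_le_add_left (hweight v) _)

theorem card_pow_mul_sum_hammingNorm_le_of_le_add [Zero G] [Nonempty G] {F : ℕ → R}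
    (hF : Monotone F) {K N m : ℕ} (h : N ≤ K + m) :
    (Fintype.card G : R) ^ K * ∑ z : Fin N → G, F (hammingNorm z) ≤
      (Fintype.card G : R) ^ N * ∑ u : Fin K → G, F (hammingNorm u + m) := by
  obtain ⟨j, hj⟩ := Nat.exists_eq_add_of_le h
  have hcompare := (card_pow_mul_sum_hammingNorm_le hF N j).trans
    (hj ▸ sum_hammingNorm_le_card_pow_mul (G := G) hF K m)
  have hG : (0 : R) < Fintype.card G := by exact_mod_cast Fintype.card_pos
  refine le_of_mul_le_mul_left ?_ (pow_pos hG j)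
  calc (Fintype.card G : R) ^ j *
        (Fintype.card G ^ K * ∑ z : Fin N → G, F (hammingNorm z))
      = Fintype.card G ^ K * (Fintype.card G ^ j * ∑ z : Fin N → G, F (hammingNorm z)) :=
        mul_left_comm _ _ _
    _ ≤ Fintype.card G ^ K * (Fintype.card G ^ m * ∑ u : Fin K → G, F (hammingNorm u + m)) := by
        gcongr
    _ = Fintype.card G ^ j * (Fintype.card G ^ N * ∑ u : Fin K → G, F (hammingNorm u + m)) := by
        rw [← mul_assoc, ← mul_assoc, ← pow_add, ← pow_add, hj, add_comm j]

theorem sum_hammingDist_right [AddGroup G] {ι M : Type*} [Fintype ι] [DecidableEq ι]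
    [AddCommMonoid M] (v : ι → G) (F : ℕ → M) :
    ∑ u : ι → G, F (hammingDist u v) = ∑ u : ι → G, F (hammingNorm u) := by
  simp only [hammingDist_eq_hammingNorm]
  exact ((Equiv.neg (ι → G)).trans (Equiv.addRight v)).sum_comp fun u => F (hammingNorm u)

end HammingWeight

section ProductLaw

theorem sum_prod_mul_sum_apply {ι α R : Type*} [Fintype ι] [DecidableEq ι] [Fintype α]
    [CommSemiring R] {p : α → R} (hp : ∑ x, p x = 1) (f : α → R) :
    ∑ z : ι → α, (∏ i, p (z i)) * ∑ i, f (z i) = Fintype.card ι * ∑ x, p x * f x := by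
  have hcoord (i : ι) : ∑ z : ι → α, (∏ j, p (z j)) * f (z i) = ∑ x, p x * f x := by
    calc ∑ z : ι → α, (∏ j, p (z j)) * f (z i)
        = ∑ z : ι → α, ∏ j, p (z j) * (if j = i then f (z j) else 1) := by
          simp only [Finset.prod_mul_distrib, Finset.prod_ite_eq', Finset.mem_univ, if_true]
      _ = ∏ j, ∑ x, p x * (if j = i then f x else 1) :=
          (Fintype.prod_sum fun j x => p x * (if j = i then f x else 1)).symm
      _ = ∏ j, if j = i then ∑ x, p x * f x else 1 := by
          refine Finset.prod_congr rfl fun j _ => ?_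
          split_ifs <;> simp [hp]
      _ = ∑ x, p x * f x := by simp only [Finset.prod_ite_eq', Finset.mem_univ, if_true]
  simp only [Finset.mul_sum]
  rw [Finset.sum_comm]
  simp only [hcoord, Finset.sum_const, Finset.card_univ, nsmul_eq_mul, Finset.mul_sum]

theorem sum_prod_eq_one {α : Type*} [Fintype α] {p : α → ℝ} (hp : p ∈ stdSimplex ℝ α) (n : ℕ) :
    ∑ z : Fin n → α, ∏ i, p (z i) = 1 := by
  rw [← Fintype.sum_pow, hp.2, one_pow]

theorem uncurry_mem_stdSimplex {α β : Type*} [Fintype α] [Fintype β] {p : α → ℝ} {r : β → ℝ}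
    {f : α → β → ℝ} (hp : p ∈ stdSimplex ℝ α) (hr : r ∈ stdSimplex ℝ β)
    (hf : ∀ a b, f a b = p a * r b) : Function.uncurry f ∈ stdSimplex ℝ (α × β) := by
  refine ⟨fun x => (mul_nonneg (hp.1 x.1) (hr.1 x.2)).trans_eq (hf x.1 x.2).symm, ?_⟩
  simp only [Fintype.sum_prod_type, Function.uncurry_apply_pair, hf, ← Finset.mul_sum, hr.2,
    mul_one, hp.2]

theorem sum_prod_mul_hammingNorm {G : Type*} [Fintype G] [DecidableEq G] [Zero G] {p : G → ℝ}
    (hp : p ∈ stdSimplex ℝ G) (n : ℕ) :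
    ∑ z : Fin n → G, (∏ i, p (z i)) * (hammingNorm z : ℝ) = n * (1 - p 0) := by
  have herror : ∑ x, p x * (if x = 0 then 0 else 1) = 1 - p 0 := by
    calc ∑ x, p x * (if x = 0 then 0 else 1) = ∑ x, (p x - if x = 0 then p x else 0) :=
          Finset.sum_congr rfl fun x _ => by split_ifs <;> simp
      _ = 1 - p 0 := by rw [Finset.sum_sub_distrib, hp.2, Fintype.sum_ite_eq' 0 p]
  have h := sum_prod_mul_sum_apply (ι := Fin n) hp.2 fun x => if x = 0 then 0 else 1
  rw [herror, Fintype.card_fin] at h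
  simpa only [hammingNorm, Finset.card_filter, ne_eq, ite_not, Nat.cast_sum, Nat.cast_ite,
    Nat.cast_one, Nat.cast_zero] using h

end ProductLaw

/-- Probability laws on a finite alphabet that are constant away from `0`, where they are largest.
For noise with such a law, the likelihood of a noise word decreases with its Hamming weight. -/
structure IsSymmetricNoise {G : Type*} [Fintype G] [Zero G] (p : G → ℝ) : Prop where
  mem_stdSimplex : p ∈ stdSimplex ℝ G
  le_apply_zero : ∀ z, p z ≤ p 0
  eq_of_ne_zero : ∀ z w, z ≠ 0 → w ≠ 0 → p z = p w

namespace IsSymmetricNoise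

variable {G : Type*} [Fintype G] [Zero G] {p : G → ℝ}

theorem exists_eq_off_zero (hp : IsSymmetricNoise p) :
    ∃ β, 0 ≤ β ∧ β ≤ p 0 ∧ ∀ z, z ≠ 0 → p z = β := by
  by_cases h : ∃ w : G, w ≠ 0
  · obtain ⟨w, hw⟩ := h
    exact ⟨p w, hp.mem_stdSimplex.1 w, hp.le_apply_zero w, fun z hz => hp.eq_of_ne_zero z w hz hw⟩
  · exact ⟨0, le_rfl, hp.mem_stdSimplex.1 0, fun z hz => absurd ⟨z, hz⟩ h⟩

theorem exists_antitone_prod_eq [DecidableEq G] (hp : IsSymmetricNoise p) (n : ℕ) :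
    ∃ w : ℕ → ℝ, Antitone w ∧ (∀ k, 0 ≤ w k) ∧
      ∀ z : Fin n → G, ∏ i, p (z i) = w (hammingNorm z) := by
  obtain ⟨β, hβ₀, hβ, hpβ⟩ := hp.exists_eq_off_zero
  have hp₀ : 0 ≤ p 0 := hβ₀.trans hβ
  refine ⟨fun k => p 0 ^ (n - k) * β ^ min n k, antitone_nat_of_succ_le fun k => ?_,
    fun k => by positivity, fun z => ?_⟩
  · rcases lt_or_ge k n with hk | hk
    · rw [min_eq_right hk, min_eq_right hk.le, show n - k = n - (k + 1) + 1 by omega, pow_succ,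
        pow_succ, mul_assoc, mul_comm (p 0)]
      gcongr
    · rw [min_eq_left hk, min_eq_left (by omega), Nat.sub_eq_zero_of_le hk,
        Nat.sub_eq_zero_of_le (by omega)]
  · have hle : hammingNorm z ≤ n := by simpa using hammingNorm_le_card_fintype (x := z)
    have hcard := Finset.card_filter_add_card_filter_not (s := Finset.univ) fun i => z i = 0
    have hzero : ({i | z i = 0} : Finset (Fin n)).card = n - hammingNorm z := by
      rw [Finset.card_univ, Fintype.card_fin] at hcard
      exact (Nat.sub_eq_of_eq_add hcard.symm).symm
    dsimp only
    rw [min_eq_right hle, ← hzero, hammingNorm,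
      ← Finset.prod_filter_mul_prod_filter_not Finset.univ fun i => z i = 0]
    congr 1
    · exact Finset.prod_eq_pow_card fun i hi => by rw [(Finset.mem_filter.1 hi).2]
    · exact Finset.prod_eq_pow_card fun i hi => hpβ _ (Finset.mem_filter.1 hi).2

end IsSymmetricNoise

section CausalShift

variable {G : Type*} [AddGroup G] {N : ℕ} (φ : (n : Fin N) → (Fin n → G) → G)

theorem causal_sub_injective :
    Function.Injective fun (y : Fin N → G) n => y n - φ n (past y n) := by
  intro y y' h
  funext n
  induction n using WellFoundedLT.induction with
  | ind n ih =>
    have hpast : past y n = past y' n := funext fun i => ih _ (Fin.lt_def.2 i.isLt)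
    simpa only [hpast, sub_left_inj] using congrFun h n

theorem sum_causal_sub [Fintype G] {M : Type*} [AddCommMonoid M] (H : (Fin N → G) → M) :
    ∑ y : Fin N → G, H (fun n => y n - φ n (past y n)) = ∑ z, H z :=
  (Finite.injective_iff_bijective.1 (causal_sub_injective φ)).sum_comp H

end CausalShift

/-- The code with the two terminals exchanged. -/
def TWCode.swap {U₁ U₂ X₁ X₂ Y₁ Y₂ : Type*} {K N : ℕ} (c : TWCode U₁ U₂ X₁ X₂ Y₁ Y₂ K N) :
    TWCode U₂ U₁ X₂ X₁ Y₂ Y₁ K N where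
  f₁ := c.f₂
  f₂ := c.f₁
  g₁ := c.g₂
  g₂ := c.g₁

theorem swap_scalarCode {U₁ U₂ X₁ X₂ Y₁ Y₂ : Type*} (h₁ : U₁ → X₁) (h₂ : U₂ → X₂)
    (g₁ : U₁ → Y₁ → U₂) (g₂ : U₂ → Y₂ → U₁) (N : ℕ) :
    (scalarCode h₁ h₂ g₁ g₂ N).swap = scalarCode h₂ h₁ g₂ g₁ N :=
  rfl

/-- The two-way channel with the two terminals exchanged. -/
def swapChannel {X₁ X₂ Y₁ Y₂ : Type*} (W : X₁ → X₂ → Y₁ → Y₂ → ℝ) : X₂ → X₁ → Y₂ → Y₁ → ℝ :=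
  fun x₂ x₁ y₂ y₁ => W x₁ x₂ y₁ y₂

section Distortion

variable {U₁ U₂ X₁ X₂ Y₁ Y₂ : Type*} [Fintype U₁] [Fintype U₂] [Fintype Y₁] [Fintype Y₂] {K N : ℕ}
  (pS : U₁ → U₂ → ℝ) (W : X₁ → X₂ → Y₁ → Y₂ → ℝ)

theorem expDistortion₁_swap (d : U₂ → U₂ → ℝ) (c : TWCode U₁ U₂ X₁ X₂ Y₁ Y₂ K N) :
    expDistortion₁ (flip pS) (swapChannel W) d c.swap = expDistortion₂ pS W d c := by
  rw [expDistortion₁, expDistortion₂, Finset.sum_comm]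
  exact Finset.sum_congr rfl fun _ _ => Finset.sum_congr rfl fun _ _ => Finset.sum_comm

theorem expDistortion₂_swap (d : U₁ → U₁ → ℝ) (c : TWCode U₁ U₂ X₁ X₂ Y₁ Y₂ K N) :
    expDistortion₂ (flip pS) (swapChannel W) d c.swap = expDistortion₁ pS W d c :=
  (expDistortion₁_swap (flip pS) (swapChannel W) d c.swap).symm

theorem Achievable.swap {pS : U₁ → U₂ → ℝ} {W : X₁ → X₂ → Y₁ → Y₂ → ℝ} {d₁ : U₁ → U₁ → ℝ}
    {d₂ : U₂ → U₂ → ℝ} {r D₁ D₂ : ℝ} (h : Achievable pS W d₁ d₂ r D₁ D₂) :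
    Achievable (flip pS) (swapChannel W) d₂ d₁ r D₂ D₁ := by
  obtain ⟨N, c, hN, hr, h₁, h₂⟩ := h
  exact ⟨N, fun K => (c K).swap, hN, hr, by simpa only [expDistortion₁_swap] using h₂,
    by simpa only [expDistortion₂_swap] using h₁⟩

/-- Expected distortion of the reconstruction, at terminal 2, of the source of terminal 1, given
both source blocks. -/
noncomputable def condDistortion₁ (d : U₁ → U₁ → ℝ) (c : TWCode U₁ U₂ X₁ X₂ Y₁ Y₂ K N)
    (u₁ : Fin K → U₁) (u₂ : Fin K → U₂) : ℝ :=
  ∑ y₁ : Fin N → Y₁, ∑ y₂ : Fin N → Y₂,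
    (∏ n, W (c.f₁ n u₁ (past y₁ n)) (c.f₂ n u₂ (past y₂ n)) (y₁ n) (y₂ n)) *
      blockDistortion d u₁ (c.g₂ u₂ y₂)

theorem expDistortion₁_eq_sum_condDistortion₁ (d : U₁ → U₁ → ℝ)
    (c : TWCode U₁ U₂ X₁ X₂ Y₁ Y₂ K N) :
    expDistortion₁ pS W d c =
      ∑ u₁, ∑ u₂, (∏ m, pS (u₁ m) (u₂ m)) * condDistortion₁ W d c u₁ u₂ := by
  simp only [expDistortion₁, jointProb, condDistortion₁, Finset.mul_sum, mul_assoc]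

variable {pS} in
theorem sum_prod_source_eq_one (hpS : Function.uncurry pS ∈ stdSimplex ℝ (U₁ × U₂)) (K : ℕ) :
    ∑ u₁ : Fin K → U₁, ∑ u₂ : Fin K → U₂, ∏ m, pS (u₁ m) (u₂ m) = 1 := by
  rw [← Fintype.sum_prod_type', ← sum_prod_eq_one hpS K]
  exact ((Equiv.arrowProdEquivProdArrow (Fin K) (fun _ => U₁) fun _ => U₂).sum_comp
    fun u : (Fin K → U₁) × (Fin K → U₂) => ∏ m, pS (u.1 m) (u.2 m)).symm

end Distortion

theorem blockDistortion_hamming {U : Type*} [DecidableEq U] {K : ℕ} (u v : Fin K → U) :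
    blockDistortion hamming u v = (K : ℝ)⁻¹ * hammingDist u v := by
  simp only [blockDistortion, hamming, hammingDist, Finset.card_filter, Nat.cast_sum, ne_eq,
    ite_not, Nat.cast_ite, Nat.cast_zero, Nat.cast_one]

/-- The two-way channel `Yᵢ = sᵢ(X₁, X₂) + Zᵢ` with independent noises `Zᵢ` of law `pᵢ`. -/
def additiveNoiseChannel {X₁ X₂ G₁ G₂ : Type*} [AddGroup G₁] [AddGroup G₂] (s₁ : X₁ → X₂ → G₁)
    (s₂ : X₁ → X₂ → G₂) (p₁ : G₁ → ℝ) (p₂ : G₂ → ℝ) (x₁ : X₁) (x₂ : X₂) (y₁ : G₁) (y₂ : G₂) : ℝ :=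
  p₁ (y₁ - s₁ x₁ x₂) * p₂ (y₂ - s₂ x₁ x₂)

theorem swapChannel_additiveNoiseChannel {X₁ X₂ G₁ G₂ : Type*} [AddGroup G₁] [AddGroup G₂]
    (s₁ : X₁ → X₂ → G₁) (s₂ : X₁ → X₂ → G₂) (p₁ : G₁ → ℝ) (p₂ : G₂ → ℝ) :
    swapChannel (additiveNoiseChannel s₁ s₂ p₁ p₂) =
      additiveNoiseChannel (flip s₂) (flip s₁) p₂ p₁ := by
  funext x₂ x₁ y₂ y₁
  exact mul_comm _ _

/-- The noise word at a terminal which receives `y`, when the received blocks are `y₁` and `y₂`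
and `s` is the noiseless channel to that terminal. -/
def TWCode.noiseWord {U₁ U₂ X₁ X₂ Y₁ Y₂ G : Type*} [AddGroup G] {K N : ℕ}
    (c : TWCode U₁ U₂ X₁ X₂ Y₁ Y₂ K N) (s : X₁ → X₂ → G) (u₁ : Fin K → U₁) (u₂ : Fin K → U₂)
    (y₁ : Fin N → Y₁) (y₂ : Fin N → Y₂) (y : Fin N → G) (n : Fin N) : G :=
  y n - s (c.f₁ n u₁ (past y₁ n)) (c.f₂ n u₂ (past y₂ n))

section ReceivedWord

variable {U₁ U₂ X₁ X₂ G₁ Y₂ : Type*} [AddGroup G₁] [Fintype G₁] {K N : ℕ}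
  (c : TWCode U₁ U₂ X₁ X₂ G₁ Y₂ K N) (s₁ : X₁ → X₂ → G₁) (u₁ : Fin K → U₁) (u₂ : Fin K → U₂)

theorem sum_noiseWord_left {M : Type*} [AddCommMonoid M] (y₂ : Fin N → Y₂)
    (H : (Fin N → G₁) → M) :
    ∑ y₁, H (c.noiseWord s₁ u₁ u₂ y₁ y₂ y₁) = ∑ z, H z :=
  sum_causal_sub (fun n h => s₁ (c.f₁ n u₁ h) (c.f₂ n u₂ (past y₂ n))) H

theorem sum_prod_mul_received [Fintype Y₂] {p₁ : G₁ → ℝ} (hp₁ : p₁ ∈ stdSimplex ℝ G₁)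
    (F : (Fin N → Y₂) → ℝ) :
    ∑ y₁, ∑ y₂, (∏ n, p₁ (c.noiseWord s₁ u₁ u₂ y₁ y₂ y₁ n)) * F y₂ = ∑ y₂, F y₂ := by
  rw [Finset.sum_comm]
  refine Finset.sum_congr rfl fun y₂ _ => ?_
  rw [← Finset.sum_mul, sum_noiseWord_left c s₁ u₁ u₂ y₂ fun z => ∏ n, p₁ (z n),
    sum_prod_eq_one hp₁, one_mul]

end ReceivedWord

section AdditiveNoise

variable {U₁ U₂ X₁ X₂ G₁ G : Type*} [AddGroup G₁] [AddGroup G] {K N : ℕ}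
  (c : TWCode U₁ U₂ X₁ X₂ G₁ G K N) (s₁ : X₁ → X₂ → G₁) (s₂ : X₁ → X₂ → G)
  (u₁ : Fin K → U₁) (u₂ : Fin K → U₂)

theorem prod_additiveNoiseChannel (p₁ : G₁ → ℝ) (p₂ : G → ℝ) (y₁ : Fin N → G₁) (y₂ : Fin N → G) :
    ∏ n, additiveNoiseChannel s₁ s₂ p₁ p₂ (c.f₁ n u₁ (past y₁ n)) (c.f₂ n u₂ (past y₂ n))
        (y₁ n) (y₂ n) =
      (∏ n, p₁ (c.noiseWord s₁ u₁ u₂ y₁ y₂ y₁ n)) * ∏ n, p₂ (c.noiseWord s₂ u₁ u₂ y₁ y₂ y₂ n) :=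
  Finset.prod_mul_distrib

variable [Fintype G₁] [Fintype G]

theorem sum_noiseWord_noiseWord {M : Type*} [AddCommMonoid M]
    (H : (Fin N → G₁) → (Fin N → G) → M) :
    ∑ y₁, ∑ y₂, H (c.noiseWord s₁ u₁ u₂ y₁ y₂ y₁) (c.noiseWord s₂ u₁ u₂ y₁ y₂ y₂) =
      ∑ z₁, ∑ z₂, H z₁ z₂ := by
  let e := Equiv.arrowProdEquivProdArrow (Fin N) (fun _ => G₁) fun _ => G
  rw [← Fintype.sum_prod_type', ← Fintype.sum_prod_type', ← e.sum_comp, ← e.sum_comp]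
  -- The pair of received symbols is a causal shift of the pair of noises in `G₁ × G`.
  exact sum_causal_sub (G := G₁ × G) (fun n h =>
    (s₁ (c.f₁ n u₁ (Prod.fst ∘ h)) (c.f₂ n u₂ (Prod.snd ∘ h)),
      s₂ (c.f₁ n u₁ (Prod.fst ∘ h)) (c.f₂ n u₂ (Prod.snd ∘ h))))
    fun z => H (e z).1 (e z).2

variable {p₁ : G₁ → ℝ}

theorem sum_prod_mul_noiseWord (hp₁ : p₁ ∈ stdSimplex ℝ G₁) (F : (Fin N → G) → ℝ) :
    ∑ y₁, ∑ y₂, (∏ n, p₁ (c.noiseWord s₁ u₁ u₂ y₁ y₂ y₁ n)) *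
      F (c.noiseWord s₂ u₁ u₂ y₁ y₂ y₂) = ∑ z, F z := by
  rw [sum_noiseWord_noiseWord c s₁ s₂ u₁ u₂ fun z₁ z₂ => (∏ n, p₁ (z₁ n)) * F z₂,
    ← Fintype.sum_mul_sum, sum_prod_eq_one hp₁, one_mul]

variable {p₂ : G → ℝ}

theorem condDistortion₁_hamming [DecidableEq U₁] :
    condDistortion₁ (additiveNoiseChannel s₁ s₂ p₁ p₂) hamming c u₁ u₂ =
      (K : ℝ)⁻¹ * ∑ y₁, ∑ y₂, (∏ n, p₁ (c.noiseWord s₁ u₁ u₂ y₁ y₂ y₁ n)) *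
        ((∏ n, p₂ (c.noiseWord s₂ u₁ u₂ y₁ y₂ y₂ n)) * hammingDist u₁ (c.g₂ u₂ y₂)) := by
  simp only [condDistortion₁, prod_additiveNoiseChannel, blockDistortion_hamming, Finset.mul_sum]
  refine Finset.sum_congr rfl fun y₁ _ => Finset.sum_congr rfl fun y₂ _ => ?_
  ring

theorem condDistortion₁_hamming_le_one [DecidableEq U₁] (hp₁ : p₁ ∈ stdSimplex ℝ G₁)
    (hp₂ : p₂ ∈ stdSimplex ℝ G) :
    condDistortion₁ (additiveNoiseChannel s₁ s₂ p₁ p₂) hamming c u₁ u₂ ≤ 1 := by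
  have hdist (v : Fin K → U₁) : hammingDist u₁ v ≤ K :=
    hammingDist_le_card_fintype.trans_eq (Fintype.card_fin K)
  have htotal := sum_prod_mul_noiseWord c s₁ s₂ u₁ u₂ hp₁ fun z => (∏ n, p₂ (z n)) * (K : ℝ)
  rw [← Finset.sum_mul, sum_prod_eq_one hp₂, one_mul] at htotal
  rw [condDistortion₁_hamming]
  refine le_trans (mul_le_mul_of_nonneg_left ?_ (by positivity)) (inv_mul_le_one (a := (K : ℝ)))
  refine le_of_le_of_eq ?_ htotal
  gcongr with y₁ _ y₂ _
  · exact Finset.prod_nonneg fun n _ => hp₁.1 _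
  · exact Finset.prod_nonneg fun n _ => hp₂.1 _
  · exact hdist _

theorem expDistortion₁_hamming_le_one [DecidableEq U₁] [Fintype U₁] [Fintype U₂]
    {pS : U₁ → U₂ → ℝ} (hpS : Function.uncurry pS ∈ stdSimplex ℝ (U₁ × U₂))
    (hp₁ : p₁ ∈ stdSimplex ℝ G₁) (hp₂ : p₂ ∈ stdSimplex ℝ G) :
    expDistortion₁ pS (additiveNoiseChannel s₁ s₂ p₁ p₂) hamming c ≤ 1 := by
  rw [expDistortion₁_eq_sum_condDistortion₁, ← sum_prod_source_eq_one hpS K]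
  refine Finset.sum_le_sum fun u₁ _ => Finset.sum_le_sum fun u₂ _ => ?_
  exact mul_le_of_le_one_right (Finset.prod_nonneg fun m _ => hpS.1 (u₁ m, u₂ m))
    (condDistortion₁_hamming_le_one c s₁ s₂ u₁ u₂ hp₁ hp₂)

end AdditiveNoise

section ScalarCode

variable {U₁ U₂ X₁ X₂ G₁ G : Type*} [DecidableEq U₁] [AddGroup G₁] [Fintype G₁] [AddGroup G]
  [Fintype G] {h₁ : U₁ → X₁} {h₂ : U₂ → X₂} {g₁ : U₁ → G₁ → U₂} {g₂ : U₂ → G → U₁}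
  {s₁ : X₁ → X₂ → G₁} {s₂ : X₁ → X₂ → G} {p₁ : G₁ → ℝ} {p₂ : G → ℝ} {N : ℕ}

theorem condDistortion₁_scalarCode (hg₂ : ∀ u₁ u₂ y, g₂ u₂ y = u₁ ↔ y = s₂ (h₁ u₁) (h₂ u₂))
    (hp₁ : p₁ ∈ stdSimplex ℝ G₁) (hp₂ : p₂ ∈ stdSimplex ℝ G) (hN : 0 < N)
    (u₁ : Fin N → U₁) (u₂ : Fin N → U₂) :
    condDistortion₁ (additiveNoiseChannel s₁ s₂ p₁ p₂) hamming (scalarCode h₁ h₂ g₁ g₂ N) u₁ u₂ =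
      1 - p₂ 0 := by
  classical
  have hdist (y₁ : Fin N → G₁) (y₂ : Fin N → G) :
      hammingDist u₁ ((scalarCode h₁ h₂ g₁ g₂ N).g₂ u₂ y₂) =
        hammingNorm ((scalarCode h₁ h₂ g₁ g₂ N).noiseWord s₂ u₁ u₂ y₁ y₂ y₂) := by
    refine congrArg Finset.card (Finset.filter_congr fun n _ => ?_)
    exact not_congr (eq_comm.trans ((hg₂ _ _ _).trans sub_eq_zero.symm))
  have herrors := sum_prod_mul_noiseWord (scalarCode h₁ h₂ g₁ g₂ N) s₁ s₂ u₁ u₂ hp₁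
    fun z => (∏ n, p₂ (z n)) * (hammingNorm z : ℝ)
  simp only [← hdist, sum_prod_mul_hammingNorm hp₂] at herrors
  rw [condDistortion₁_hamming, herrors, inv_mul_cancel_left₀ (by exact_mod_cast hN.ne')]

theorem expDistortion₁_scalarCode [Fintype U₁] [Fintype U₂] {pS : U₁ → U₂ → ℝ}
    (hpS : Function.uncurry pS ∈ stdSimplex ℝ (U₁ × U₂))
    (hg₂ : ∀ u₁ u₂ y, g₂ u₂ y = u₁ ↔ y = s₂ (h₁ u₁) (h₂ u₂))
    (hp₁ : p₁ ∈ stdSimplex ℝ G₁) (hp₂ : p₂ ∈ stdSimplex ℝ G) (hN : 0 < N) :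
    expDistortion₁ pS (additiveNoiseChannel s₁ s₂ p₁ p₂) hamming (scalarCode h₁ h₂ g₁ g₂ N) =
      1 - p₂ 0 := by
  simp only [expDistortion₁_eq_sum_condDistortion₁, condDistortion₁_scalarCode hg₂ hp₁ hp₂ hN,
    ← Finset.sum_mul, sum_prod_source_eq_one hpS, one_mul]

end ScalarCode

section Converse

variable {U₂ X₁ X₂ G₁ G : Type*} [AddGroup G₁] [Fintype G₁] [AddGroup G] [Fintype G]
  [DecidableEq G] {s₁ : X₁ → X₂ → G₁} {s₂ : X₁ → X₂ → G} {p₁ : G₁ → ℝ} {p₂ : G → ℝ} {K N : ℕ}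

-- The weights keep the noise of terminal 1 but make that of terminal 2 uniform, so that the
-- received word `y₂` becomes uniform and independent of `u₁`.
theorem sum_noiseWord_le_sum_hammingDist (hp₁ : p₁ ∈ stdSimplex ℝ G₁)
    (c : TWCode G U₂ X₁ X₂ G₁ G K N) (u₂ : Fin K → U₂) {F : ℕ → ℝ} (hF : Monotone F) {m : ℕ}
    (hm : N ≤ K + m) :
    ∑ u₁, ∑ y₁, ∑ y₂, (∏ n, p₁ (c.noiseWord s₁ u₁ u₂ y₁ y₂ y₁ n)) *
        F (hammingNorm (c.noiseWord s₂ u₁ u₂ y₁ y₂ y₂)) ≤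
      ∑ u₁, ∑ y₁, ∑ y₂, (∏ n, p₁ (c.noiseWord s₁ u₁ u₂ y₁ y₂ y₁ n)) *
        F (hammingDist u₁ (c.g₂ u₂ y₂) + m) := by
  calc _ = (Fintype.card G : ℝ) ^ K * ∑ z : Fin N → G, F (hammingNorm z) := by
        simp only [sum_prod_mul_noiseWord c s₁ s₂ _ u₂ hp₁ fun z => F (hammingNorm z),
          Finset.sum_const, Finset.card_univ, Fintype.card_fun, Fintype.card_fin, nsmul_eq_mul,
          Nat.cast_pow]
    _ ≤ (Fintype.card G : ℝ) ^ N * ∑ u : Fin K → G, F (hammingNorm u + m) :=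
        card_pow_mul_sum_hammingNorm_le_of_le_add hF hm
    _ = ∑ u₁ : Fin K → G, ∑ y₂ : Fin N → G, F (hammingDist u₁ (c.g₂ u₂ y₂) + m) := by
        rw [Finset.sum_comm]
        simp only [sum_hammingDist_right _ fun k => F (k + m), Finset.sum_const, Finset.card_univ,
          Fintype.card_fun, Fintype.card_fin, nsmul_eq_mul, Nat.cast_pow]
    _ = _ := by
        exact Finset.sum_congr rfl fun u₁ _ => (sum_prod_mul_received c s₁ u₁ u₂ hp₁ fun y₂ =>
          F (hammingDist u₁ (c.g₂ u₂ y₂) + m)).symm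

theorem card_pow_mul_le_sum_hammingDist_add (hp₁ : p₁ ∈ stdSimplex ℝ G₁)
    (hp₂ : IsSymmetricNoise p₂) (c : TWCode G U₂ X₁ X₂ G₁ G K N) (u₂ : Fin K → U₂) {m : ℕ}
    (hm : N ≤ K + m) :
    (Fintype.card G : ℝ) ^ K * (N * (1 - p₂ 0)) ≤
      ∑ u₁, ∑ y₁, ∑ y₂, (∏ n, p₁ (c.noiseWord s₁ u₁ u₂ y₁ y₂ y₁ n)) *
        ((∏ n, p₂ (c.noiseWord s₂ u₁ u₂ y₁ y₂ y₂ n)) *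
          (hammingDist u₁ (c.g₂ u₂ y₂) + m : ℕ)) := by
  obtain ⟨w, hw, hw₀, hpw⟩ := hp₂.exists_antitone_prod_eq N
  let P (ω : (Fin K → G) × (Fin N → G₁) × (Fin N → G)) : ℝ :=
    ∏ n, p₁ (c.noiseWord s₁ ω.1 u₂ ω.2.1 ω.2.2 ω.2.1 n)
  let noise (ω : (Fin K → G) × (Fin N → G₁) × (Fin N → G)) : ℕ :=
    hammingNorm (c.noiseWord s₂ ω.1 u₂ ω.2.1 ω.2.2 ω.2.2)
  let errors (ω : (Fin K → G) × (Fin N → G₁) × (Fin N → G)) : ℕ :=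
    hammingDist ω.1 (c.g₂ u₂ ω.2.2)
  have hmean : ∑ ω, P ω * (w (noise ω) * noise ω) =
      (Fintype.card G : ℝ) ^ K * (N * (1 - p₂ 0)) := by
    simp only [Fintype.sum_prod_type, P, noise, ← hpw, Finset.sum_const, Finset.card_univ,
      sum_prod_mul_noiseWord c s₁ s₂ _ u₂ hp₁ fun z => (∏ n, p₂ (z n)) * (hammingNorm z : ℝ),
      sum_prod_mul_hammingNorm hp₂.mem_stdSimplex, Fintype.card_fun, Fintype.card_fin,
      nsmul_eq_mul, Nat.cast_pow]
  have hdominated : ∑ ω, P ω * (w (noise ω) * noise ω) ≤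
      ∑ ω, P ω * (w (noise ω) * (errors ω + m : ℕ)) := by
    refine sum_mul_antitone_mul_le_of_dominated
      (fun ω _ => Finset.prod_nonneg fun n _ => hp₁.1 _) hw hw₀ fun F hF => ?_
    simpa only [Fintype.sum_prod_type] using
      sum_noiseWord_le_sum_hammingDist hp₁ c u₂ hF hm
  rw [hmean] at hdominated
  simpa only [Fintype.sum_prod_type, P, noise, errors, ← hpw] using hdominated

theorem card_pow_mul_le_sum_condDistortion₁ (hp₁ : p₁ ∈ stdSimplex ℝ G₁)
    (hp₂ : IsSymmetricNoise p₂) (c : TWCode G U₂ X₁ X₂ G₁ G K N) (u₂ : Fin K → U₂) :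
    (Fintype.card G : ℝ) ^ K * ((K : ℝ)⁻¹ * (N * (1 - p₂ 0) - (N - K : ℕ))) ≤
      ∑ u₁, condDistortion₁ (additiveNoiseChannel s₁ s₂ p₁ p₂) hamming c u₁ u₂ := by
  have htotal (u₁ : Fin K → G) :=
    sum_prod_mul_noiseWord c s₁ s₂ u₁ u₂ hp₁ fun z => (∏ n, p₂ (z n)) * ((N - K : ℕ) : ℝ)
  have hbound := card_pow_mul_le_sum_hammingDist_add (s₁ := s₁) (s₂ := s₂) hp₁ hp₂ c u₂
    (m := N - K) le_add_tsub
  simp only [Nat.cast_add, mul_add, Finset.sum_add_distrib, htotal] at hbound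
  simp only [← Finset.sum_mul, sum_prod_eq_one hp₂.mem_stdSimplex, one_mul, Finset.sum_const,
    Finset.card_univ, Fintype.card_fun, Fintype.card_fin, nsmul_eq_mul, Nat.cast_pow] at hbound
  simp only [condDistortion₁_hamming, ← Finset.mul_sum]
  rw [mul_left_comm]
  refine mul_le_mul_of_nonneg_left ?_ (by positivity)
  linarith

variable [Fintype U₂] {r : U₂ → ℝ} {pS : G → U₂ → ℝ}

theorem le_expDistortion₁ (hr : r ∈ stdSimplex ℝ U₂)
    (hpS : ∀ u v, pS u v = (Fintype.card G : ℝ)⁻¹ * r v) (hp₁ : p₁ ∈ stdSimplex ℝ G₁)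
    (hp₂ : IsSymmetricNoise p₂) (c : TWCode G U₂ X₁ X₂ G₁ G K N) :
    (K : ℝ)⁻¹ * (N * (1 - p₂ 0) - (N - K : ℕ)) ≤
      expDistortion₁ pS (additiveNoiseChannel s₁ s₂ p₁ p₂) hamming c := by
  have hG : (Fintype.card G : ℝ) ^ K ≠ 0 := by simp
  set B : ℝ := (K : ℝ)⁻¹ * (N * (1 - p₂ 0) - (N - K : ℕ))
  calc B = ∑ u₂ : Fin K → U₂, (∏ m, r (u₂ m)) *
        (((Fintype.card G : ℝ) ^ K)⁻¹ * ((Fintype.card G : ℝ) ^ K * B)) := by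
        rw [← Finset.sum_mul, sum_prod_eq_one hr, one_mul, inv_mul_cancel_left₀ hG]
    _ ≤ ∑ u₂ : Fin K → U₂, (∏ m, r (u₂ m)) * (((Fintype.card G : ℝ) ^ K)⁻¹ *
          ∑ u₁, condDistortion₁ (additiveNoiseChannel s₁ s₂ p₁ p₂) hamming c u₁ u₂) := by
        gcongr with u₂
        · exact Finset.prod_nonneg fun m _ => hr.1 _
        · exact card_pow_mul_le_sum_condDistortion₁ hp₁ hp₂ c u₂
    _ = expDistortion₁ pS (additiveNoiseChannel s₁ s₂ p₁ p₂) hamming c := by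
        rw [expDistortion₁_eq_sum_condDistortion₁, Finset.sum_comm]
        simp only [hpS, Finset.prod_mul_distrib, Finset.prod_const, Finset.card_univ,
          Fintype.card_fin, Finset.mul_sum, inv_pow]
        refine Finset.sum_congr rfl fun u₂ _ => Finset.sum_congr rfl fun u₁ _ => ?_
        ring

end Converse

theorem tendsto_inv_mul_sub_of_rate_one {N : ℕ → ℕ}
    (hN : Tendsto (fun K : ℕ => (K : ℝ) / N K) atTop (𝓝 1)) (ε : ℝ) :
    Tendsto (fun K : ℕ => (K : ℝ)⁻¹ * (N K * ε - (N K - K : ℕ))) atTop (𝓝 ε) := by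
  have hinv : Tendsto (fun K : ℕ => (N K : ℝ) / K) atTop (𝓝 1) := by
    simpa using hN.inv₀ one_ne_zero
  have hlim := (hinv.mul_const ε).sub ((hinv.sub_const 1).max (tendsto_const_nhds (x := (0 : ℝ))))
  simp only [one_mul, sub_self, max_self, sub_zero] at hlim
  refine hlim.congr' ?_
  filter_upwards [eventually_gt_atTop 0] with K hK
  have hcast : ((N K - K : ℕ) : ℝ) = max ((N K : ℝ) - K) 0 := by
    rcases le_total (N K) K with h | h
    · rw [Nat.sub_eq_zero_of_le h, Nat.cast_zero, max_eq_right (by simpa using h)]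
    · rw [Nat.cast_sub h, max_eq_left (by simpa using h)]
  have hK' : (0 : ℝ) < K := by exact_mod_cast hK
  rw [hcast, mul_sub, mul_max_of_nonneg _ _ (by positivity), mul_zero, mul_sub,
    inv_mul_cancel₀ hK'.ne', ← mul_assoc, inv_mul_eq_div]

theorem le_limsup_of_tendsto_of_eventually_le {α β : Type*} [ConditionallyCompleteLinearOrder β]
    [TopologicalSpace β] [OrderTopology β] {l : Filter α} [l.NeBot] {f g : α → β} {a : β}
    (hf : Tendsto f l (𝓝 a)) (hg : IsBoundedUnder (· ≤ ·) l g) (hfg : ∀ᶠ x in l, f x ≤ g x) :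
    a ≤ limsup g l :=
  hf.limsup_eq.symm.trans_le (limsup_le_limsup hfg hf.isBoundedUnder_ge.isCoboundedUnder_le hg)

theorem Achievable.of_forall_eq {U₁ U₂ X₁ X₂ Y₁ Y₂ : Type*} [Fintype U₁] [Fintype U₂]
    [Fintype Y₁] [Fintype Y₂] {pS : U₁ → U₂ → ℝ} {W : X₁ → X₂ → Y₁ → Y₂ → ℝ} {d₁ : U₁ → U₁ → ℝ}
    {d₂ : U₂ → U₂ → ℝ} {D₁ D₂ : ℝ} (c : ∀ K, TWCode U₁ U₂ X₁ X₂ Y₁ Y₂ K K)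
    (h₁ : ∀ K, 0 < K → expDistortion₁ pS W d₁ (c K) = D₁)
    (h₂ : ∀ K, 0 < K → expDistortion₂ pS W d₂ (c K) = D₂) : Achievable pS W d₁ d₂ 1 D₁ D₂ := by
  have hlimsup {D : ℝ} {f : ℕ → ℝ} (hf : ∀ K, 0 < K → f K = D) : limsup f atTop ≤ D :=
    (tendsto_const_nhds.congr' ((eventually_gt_atTop 0).mono fun K hK =>
      (hf K hK).symm)).limsup_eq.le
  refine ⟨id, c, fun K hK => hK, ?_, hlimsup h₁, hlimsup h₂⟩
  refine tendsto_const_nhds.congr' ((eventually_gt_atTop 0).mono fun K hK => ?_)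
  exact (div_self (by exact_mod_cast hK.ne')).symm

section UniformSource

variable {U₂ X₁ X₂ G₁ G : Type*} [Fintype U₂] [AddGroup G₁] [Fintype G₁] [AddGroup G] [Fintype G]
  [DecidableEq G] {r : U₂ → ℝ} {pS : G → U₂ → ℝ} {s₁ : X₁ → X₂ → G₁} {s₂ : X₁ → X₂ → G}
  {p₁ : G₁ → ℝ} {p₂ : G → ℝ}

theorem Achievable.one_sub_apply_zero_le {d₂ : U₂ → U₂ → ℝ} {D₁ D₂ : ℝ}
    (h : Achievable pS (additiveNoiseChannel s₁ s₂ p₁ p₂) hamming d₂ 1 D₁ D₂)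
    (hr : r ∈ stdSimplex ℝ U₂) (hpS : ∀ u v, pS u v = (Fintype.card G : ℝ)⁻¹ * r v)
    (hp₁ : p₁ ∈ stdSimplex ℝ G₁) (hp₂ : IsSymmetricNoise p₂) : 1 - p₂ 0 ≤ D₁ := by
  obtain ⟨N, c, -, hrate, hlimsup, -⟩ := h
  refine le_trans ?_ hlimsup
  refine le_limsup_of_tendsto_of_eventually_le (tendsto_inv_mul_sub_of_rate_one hrate _)
    (isBoundedUnder_of ⟨1, fun K => ?_⟩)
    (Eventually.of_forall fun K => le_expDistortion₁ hr hpS hp₁ hp₂ (c K))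
  exact expDistortion₁_hamming_le_one (c K) s₁ s₂
    (uncurry_mem_stdSimplex stdSimplex.barycenter.2 hr hpS) hp₁ hp₂.mem_stdSimplex

theorem one_sub_apply_zero_le_expDistortion₁ {N : ℕ} (hN : 0 < N) (hr : r ∈ stdSimplex ℝ U₂)
    (hpS : ∀ u v, pS u v = (Fintype.card G : ℝ)⁻¹ * r v) (hp₁ : p₁ ∈ stdSimplex ℝ G₁)
    (hp₂ : IsSymmetricNoise p₂) (c : TWCode G U₂ X₁ X₂ G₁ G N N) :
    1 - p₂ 0 ≤ expDistortion₁ pS (additiveNoiseChannel s₁ s₂ p₁ p₂) hamming c := by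
  have hbound := le_expDistortion₁ (s₁ := s₁) (s₂ := s₂) hr hpS hp₁ hp₂ c
  rwa [Nat.sub_self, Nat.cast_zero, sub_zero,
    inv_mul_cancel_left₀ (by exact_mod_cast hN.ne')] at hbound

end UniformSource

theorem noiseLaw_zero (q : ℕ) (ε : ℝ) : noiseLaw q ε 0 = 1 - ε :=
  if_pos rfl

theorem noiseLaw_of_ne_zero {q : ℕ} (ε : ℝ) {z : ZMod q} (hz : z ≠ 0) :
    noiseLaw q ε z = ε / ((q : ℝ) - 1) :=
  if_neg hz

theorem isSymmetricNoise_noiseLaw {q : ℕ} [NeZero q] (hq : 2 ≤ q) {ε : ℝ} (hε : 0 ≤ ε)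
    (hε' : ε ≤ ((q : ℝ) - 1) / q) : IsSymmetricNoise (noiseLaw q ε) := by
  have hq₀ : (0 : ℝ) < q := Nat.cast_pos'.2 (by omega)
  have hq₁ : (0 : ℝ) < (q : ℝ) - 1 := sub_pos.2 (by exact_mod_cast hq)
  have hnonneg : 0 ≤ ε / ((q : ℝ) - 1) := div_nonneg hε hq₁.le
  have hle : ε / ((q : ℝ) - 1) ≤ 1 - ε := by
    rw [le_div_iff₀ hq₀] at hε'
    rw [div_le_iff₀ hq₁]
    linarith
  have hsum : ∑ z, noiseLaw q ε z = 1 := by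
    rw [Fintype.sum_eq_add_sum_compl 0, noiseLaw_zero, Finset.sum_congr rfl fun z hz =>
      noiseLaw_of_ne_zero ε (by simpa using hz), Finset.sum_const, Finset.card_compl,
      Finset.card_singleton, ZMod.card, nsmul_eq_mul, Nat.cast_sub (by omega), Nat.cast_one,
      mul_div_cancel₀ _ hq₁.ne', sub_add_cancel]
  have hbounds (z : ZMod q) : 0 ≤ noiseLaw q ε z ∧ noiseLaw q ε z ≤ 1 - ε := by
    rcases eq_or_ne z 0 with rfl | hz
    · exact (noiseLaw_zero q ε).symm ▸ ⟨hnonneg.trans hle, le_rfl⟩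
    · exact (noiseLaw_of_ne_zero ε hz).symm ▸ ⟨hnonneg, hle⟩
  exact ⟨⟨fun z => (hbounds z).1, hsum⟩,
    fun z => (hbounds z).2.trans_eq (noiseLaw_zero q ε).symm,
    fun z w hz hw => (noiseLaw_of_ne_zero ε hz).trans (noiseLaw_of_ne_zero ε hw).symm⟩

theorem mainTheorem6_general {G : Type*} [AddCommGroup G] [Fintype G] [DecidableEq G]
    {p₁ p₂ : G → ℝ} (hp₁ : IsSymmetricNoise p₁) (hp₂ : IsSymmetricNoise p₂) {pS : G → G → ℝ}
    (hpS : ∀ u v, pS u v = (Fintype.card G : ℝ)⁻¹ * (Fintype.card G : ℝ)⁻¹) :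
    (∀ D₁ D₂ : ℝ,
      Achievable pS (additiveNoiseChannel (· + ·) (· + ·) p₁ p₂) hamming hamming 1 D₁ D₂ →
        1 - p₂ 0 ≤ D₁ ∧ 1 - p₁ 0 ≤ D₂) ∧
    (∀ N : ℕ, 0 < N → ∀ c : TWCode G G G G G G N N,
      1 - p₂ 0 ≤ expDistortion₁ pS (additiveNoiseChannel (· + ·) (· + ·) p₁ p₂) hamming c ∧
      1 - p₁ 0 ≤ expDistortion₂ pS (additiveNoiseChannel (· + ·) (· + ·) p₁ p₂) hamming c) ∧
    (∀ N : ℕ, 0 < N →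
      expDistortion₁ pS (additiveNoiseChannel (· + ·) (· + ·) p₁ p₂) hamming
        (scalarCode id id (fun u y => y - u) (fun u y => y - u) N) = 1 - p₂ 0 ∧
      expDistortion₂ pS (additiveNoiseChannel (· + ·) (· + ·) p₁ p₂) hamming
        (scalarCode id id (fun u y => y - u) (fun u y => y - u) N) = 1 - p₁ 0) ∧
    Achievable pS (additiveNoiseChannel (· + ·) (· + ·) p₁ p₂) hamming hamming 1
      (1 - p₂ 0) (1 - p₁ 0) := by
  have huniform : (fun _ : G => (Fintype.card G : ℝ)⁻¹) ∈ stdSimplex ℝ G := stdSimplex.barycenter.2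
  have hsource := uncurry_mem_stdSimplex huniform huniform hpS
  have hflip : Function.uncurry (flip pS) ∈ stdSimplex ℝ (G × G) :=
    uncurry_mem_stdSimplex huniform huniform fun u v => hpS v u
  have hp₁' := hp₁.mem_stdSimplex
  have hp₂' := hp₂.mem_stdSimplex
  have hchannel := swapChannel_additiveNoiseChannel (fun x₁ x₂ : G => x₁ + x₂) (· + ·) p₁ p₂
  have huncoded₁ (N : ℕ) (hN : 0 < N) :
      expDistortion₁ pS (additiveNoiseChannel (· + ·) (· + ·) p₁ p₂) hamming
        (scalarCode id id (fun u y => y - u) (fun u y => y - u) N) = 1 - p₂ 0 :=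
    expDistortion₁_scalarCode hsource (fun _ _ _ => sub_eq_iff_eq_add) hp₁' hp₂' hN
  have huncoded₂ (N : ℕ) (hN : 0 < N) :
      expDistortion₂ pS (additiveNoiseChannel (· + ·) (· + ·) p₁ p₂) hamming
        (scalarCode id id (fun u y => y - u) (fun u y => y - u) N) = 1 - p₁ 0 := by
    rw [← expDistortion₁_swap, hchannel, swap_scalarCode]
    exact expDistortion₁_scalarCode hflip (fun _ _ _ => sub_eq_iff_eq_add') hp₂' hp₁' hN
  refine ⟨fun D₁ D₂ h => ⟨h.one_sub_apply_zero_le huniform hpS hp₁' hp₂, ?_⟩, fun N hN c =>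
    ⟨one_sub_apply_zero_le_expDistortion₁ hN huniform hpS hp₁' hp₂ c, ?_⟩,
    fun N hN => ⟨huncoded₁ N hN, huncoded₂ N hN⟩, .of_forall_eq _ huncoded₁ huncoded₂⟩
  · have h' := h.swap
    rw [hchannel] at h'
    exact h'.one_sub_apply_zero_le huniform (fun u v => hpS v u) hp₂' hp₁
  · rw [← expDistortion₁_swap, hchannel]
    exact one_sub_apply_zero_le_expDistortion₁ hN huniform (fun u v => hpS v u) hp₂' hp₁ c.swap

theorem mainTheorem6 (q : ℕ) [NeZero q] (hq : 2 ≤ q) (ε₁ ε₂ : ℝ)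
    (hε₁ : 0 ≤ ε₁) (hε₁' : ε₁ ≤ ((q : ℝ) - 1) / q)
    (hε₂ : 0 ≤ ε₂) (hε₂' : ε₂ ≤ ((q : ℝ) - 1) / q)
    (pS : ZMod q → ZMod q → ℝ)
    -- independent uniform sources, or binary symmetric sources of correlation `1 - 2 * δ = 0`
    (hS : (∀ u v, pS u v = 1 / (q : ℝ) * (1 / (q : ℝ))) ∨
      (q = 2 ∧ ∃ δ : ℝ, 0 ≤ δ ∧ δ ≤ 1 / 2 ∧ 1 - 2 * δ = 0 ∧
        ∀ u v, pS u v = 1 / 2 * (if u = v then 1 - δ else δ))) :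
    -- converse: every pair that is achievable at rate 1
    (∀ D₁ D₂ : ℝ, Achievable pS (additiveTWC q ε₁ ε₂) hamming hamming 1 D₁ D₂ →
      ε₂ ≤ D₁ ∧ ε₁ ≤ D₂) ∧
    -- converse at each finite blocklength, for every code with `N = K`
    (∀ N : ℕ, 0 < N →
      ∀ c : TWCode (ZMod q) (ZMod q) (ZMod q) (ZMod q) (ZMod q) (ZMod q) N N,
        ε₂ ≤ expDistortion₁ pS (additiveTWC q ε₁ ε₂) hamming c ∧
        ε₁ ≤ expDistortion₂ pS (additiveTWC q ε₁ ε₂) hamming c) ∧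
    -- uncoded transmission attains both bounds exactly, at each blocklength
    (∀ N : ℕ, 0 < N →
      expDistortion₁ pS (additiveTWC q ε₁ ε₂) hamming (uncoded q N) = ε₂ ∧
      expDistortion₂ pS (additiveTWC q ε₁ ε₂) hamming (uncoded q N) = ε₁) ∧
    -- hence the pair of bounds is itself achievable at rate 1
    Achievable pS (additiveTWC q ε₁ ε₂) hamming hamming 1 ε₂ ε₁ := by
  have hpS (u v : ZMod q) :
      pS u v = (Fintype.card (ZMod q) : ℝ)⁻¹ * (Fintype.card (ZMod q) : ℝ)⁻¹ := by
    rcases hS with hS | ⟨rfl, δ, -, -, hδ, hS⟩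
    · rw [hS, ZMod.card, one_div]
    · obtain rfl : δ = 1 / 2 := by linarith
      rw [hS, sub_half, ite_self, ZMod.card, one_div, Nat.cast_ofNat]
  have h := mainTheorem6_general (isSymmetricNoise_noiseLaw hq hε₁ hε₁')
    (isSymmetricNoise_noiseLaw hq hε₂ hε₂') hpS
  rwa [noiseLaw_zero, noiseLaw_zero, sub_sub_cancel, sub_sub_cancel] at h
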